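/- Let $A$ be a (not necessarily unital) simple separable C$^*$-algebra which has exactly one tracial state $\tau$ (a tracial state is a positive linear functional $\varphi$ of norm one with $\varphi(ab)=\varphi(ba)$ for all $a,b$), and let $\alpha$ be an action of $\mathbb{Z}_2$ on $A$ by $*$-automorphisms; write $\alpha$ also for the automorphism given by the generator. Let $(\pi_\tau,H_\tau)$ be the GNS representation of $\tau$, and let $\tilde\alpha$ be the automorphism of the von Neumann algebra $\pi_\tau(A)''$ that extends $\alpha$, i.e. $\tilde\alpha(\pi_\tau(a))=\pi_\tau(\alpha(a))$ for all $a\in A$ (it exists and is unique because $\tau\circ\alpha=\tau$). Then the set of tracial states of the crossed product $A\rtimes_\alpha\mathbb{Z}_2$ has exactly two extreme points if and only if there exists a unitary $U\in\pi_\tau(A)''$ such that $\tilde\alpha=\mathrm{Ad}(U)$ on $\pi_\tau(A)''$, i.e. $\tilde\alpha(m)=UmU^*$ for all $m\in\pi_\tau(A)''$, and $U^2=1$. -/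

import Mathlib

open scoped ComplexOrder

noncomputable section

namespace CStarDyn

/-- A C⋆-algebra is simple if it is nonzero and has no closed two-sided ideals other than `0` and
itself. (A closed two-sided ring ideal of a C⋆-algebra is automatically a complex subspace.) -/
def IsSimple (A : Type*) [NonUnitalCStarAlgebra A] : Prop :=
  Nontrivial A ∧ ∀ I : TwoSidedIdeal A, IsClosed (I : Set A) → I = ⊥ ∨ I = ⊤

/-- The set `T₁(A)` of tracial states: positive functionals of norm one with `φ (ab) = φ (ba)`. -/
def tracialStates (A : Type*) [NonUnitalCStarAlgebra A] : Set (StrongDual ℂ A) :=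
  {φ | (∀ a : A, 0 ≤ φ (star a * a)) ∧ ‖φ‖ = 1 ∧ ∀ a b : A, φ (a * b) = φ (b * a)}

theorem isometry_aut {A : Type*} [NonUnitalCStarAlgebra A] (β : A ≃⋆ₐ[ℂ] A) : Isometry β :=
  NonUnitalStarAlgHom.isometry β β.injective

theorem symm_invariant {A : Type*} [NonUnitalCStarAlgebra A] {τ : StrongDual ℂ A} {β : A ≃⋆ₐ[ℂ] A} (hβ : ∀ a, τ (β a) = τ a) (a : A) :
    τ (β.symm a) = τ a := by
  rw [← hβ (β.symm a), StarAlgEquiv.apply_symm_apply]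

theorem mem_of_unique {A : Type*} [NonUnitalCStarAlgebra A] {τ : StrongDual ℂ A}
    (hτ : tracialStates A = {τ}) : τ ∈ tracialStates A :=
  hτ ▸ Set.mem_singleton τ

/-- A unique tracial state is invariant under every automorphism. -/
theorem invariant_of_unique {A : Type*} [NonUnitalCStarAlgebra A] {τ : StrongDual ℂ A}
    (hτ : tracialStates A = {τ}) (β : A ≃⋆ₐ[ℂ] A) (a : A) : τ (β a) = τ a := by
  have hmem := mem_of_unique hτ
  let e : A ≃ₗᵢ[ℂ] A :=
    { toFun := β
      invFun := β.symm
      map_add' := map_add β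
      map_smul' := map_smul β
      left_inv := β.symm_apply_apply
      right_inv := β.apply_symm_apply
      norm_map' := NonUnitalStarAlgHom.norm_map β β.injective }
  let σ : StrongDual ℂ A := τ ∘L (e : A →L[ℂ] A)
  have hσ_apply (x : A) : σ x = τ (β x) := rfl
  have hσ : σ ∈ tracialStates A := by
    refine ⟨fun x => ?_, ?_, fun x y => ?_⟩
    · rw [hσ_apply, map_mul, map_star]
      exact hmem.1 _
    · rw [← hmem.2.1]
      exact ContinuousLinearMap.opNorm_comp_linearIsometryEquiv τ e
    · rw [hσ_apply, hσ_apply, map_mul β, map_mul β]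
      exact hmem.2.2 _ _
  rw [hτ, Set.mem_singleton_iff] at hσ
  rw [← hσ_apply, hσ]

section CrossedProduct

variable {A : Type*} [NonUnitalCStarAlgebra A]
variable {G : Type*} [Group G]

/-- For an action `α` of a finite group `G`, the operator `∑ₛ f(s) λₛ` of the regular
representation on the Hilbert module `ℓ²(G, A)`, where `(a ξ)(g) = α_{g⁻¹}(a) ξ(g)` and
`(λₛ ξ)(g) = ξ(s⁻¹ g)`, written as a `G × G` matrix over `A`. -/
def regularRep (α : G →* (A ≃⋆ₐ[ℂ] A)) (f : G → A) : CStarMatrix G G A :=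
  CStarMatrix.ofMatrix fun g h => α g⁻¹ (f (g * h⁻¹))

theorem regularRep_apply (α : G →* (A ≃⋆ₐ[ℂ] A)) (f : G → A) (g h : G) :
    regularRep α f g h = α g⁻¹ (f (g * h⁻¹)) := rfl

variable [Fintype G]

/-- The (reduced) crossed product `A ⋊_α G` of a C⋆-algebra by a finite group: the C⋆-algebra
generated by, and here equal to the set of, the operators `∑ₛ f(s) λₛ`. -/
def crossedProduct (α : G →* (A ≃⋆ₐ[ℂ] A)) : NonUnitalStarSubalgebra ℂ (CStarMatrix G G A) where
  carrier := Set.range (regularRep α)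
  zero_mem' := ⟨0, by ext g h; simp [regularRep_apply]⟩
  add_mem' := by
    rintro _ _ ⟨f, rfl⟩ ⟨k, rfl⟩
    exact ⟨f + k, by ext g h; simp [regularRep_apply]⟩
  smul_mem' := by
    rintro c _ ⟨f, rfl⟩
    exact ⟨c • f, by ext g h; simp [regularRep_apply]⟩
  mul_mem' := by
    rintro _ _ ⟨f, rfl⟩ ⟨k, rfl⟩
    refine ⟨fun s => ∑ t, f t * α t (k (t⁻¹ * s)), ?_⟩
    ext g h
    rw [CStarMatrix.mul_apply]
    simp only [regularRep_apply, map_sum, map_mul]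
    refine Fintype.sum_equiv ((Equiv.inv G).trans (Equiv.mulRight g)) _ _ fun x => ?_
    rw [← StarAlgEquiv.mul_apply (α g⁻¹), ← map_mul]
    simp [mul_assoc]
  star_mem' := by
    rintro _ ⟨f, rfl⟩
    refine ⟨fun s => α s (star (f s⁻¹)), ?_⟩
    ext g h
    simp only [regularRep_apply, CStarMatrix.star_apply, ← map_star]
    rw [← StarAlgEquiv.mul_apply, ← map_mul]
    simp

variable [PartialOrder A] [StarOrderedRing A]

instance isClosed_crossedProduct (α : G →* (A ≃⋆ₐ[ℂ] A)) :
    IsClosed (crossedProduct α : Set (CStarMatrix G G A)) := by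
  have h : (crossedProduct α : Set (CStarMatrix G G A)) =
      {M | ∀ g h : G, M g h = α g⁻¹ (M 1 (h * g⁻¹))} := by
    ext M
    constructor
    · rintro ⟨f, rfl⟩ g h
      simp [regularRep_apply]
    · intro hM
      refine ⟨fun s => M 1 s⁻¹, ?_⟩
      ext g h
      rw [regularRep_apply, hM g h]
      simp
  have hc (g h : G) : Continuous fun M : CStarMatrix G G A => M g h :=
    (continuous_apply h).comp (continuous_apply (A := fun _ : G => G → A) g)
  rw [h]
  simp only [Set.ofPred_forall]
  exact isClosed_iInter fun g => isClosed_iInter fun h =>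
    isClosed_eq (hc g h) ((isometry_aut _).continuous.comp (hc 1 _))

end CrossedProduct

section GNS

variable {A : Type*} [NonUnitalCStarAlgebra A] [PartialOrder A] [StarOrderedRing A]

/-- A tracial state as a positive linear map. -/
def toPositive {τ : StrongDual ℂ A} (hτ : τ ∈ tracialStates A) : A →ₚ[ℂ] ℂ :=
  PositiveLinearMap.mk₀ (τ : A →ₗ[ℂ] ℂ) fun x hx => by
    rw [StarOrderedRing.nonneg_iff] at hx
    induction hx using AddSubmonoid.closure_induction with
    | mem x hx => obtain ⟨a, rfl⟩ := hx; exact hτ.1 a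
    | zero => simp
    | add x y _ _ hx hy => rw [map_add]; exact add_nonneg hx hy

theorem toPositive_apply {τ : StrongDual ℂ A} (hτ : τ ∈ tracialStates A) (a : A) :
    toPositive hτ a = τ a := rfl

/-- The GNS Hilbert space `H_τ`. -/
abbrev GNSSpace {τ : StrongDual ℂ A} (hτ : τ ∈ tracialStates A) : Type _ := (toPositive hτ).GNS

/-- The GNS representation `π_τ` of `A` on `H_τ`. -/
abbrev gnsRep {τ : StrongDual ℂ A} (hτ : τ ∈ tracialStates A) :
    A →⋆ₙₐ[ℂ] (GNSSpace hτ →L[ℂ] GNSSpace hτ) :=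
  (toPositive hτ).gnsNonUnitalStarAlgHom

theorem star_range_gnsRep {τ : StrongDual ℂ A} (hτ : τ ∈ tracialStates A) :
    star (Set.range (gnsRep hτ)) = Set.range (gnsRep hτ) := by
  ext x
  constructor
  · rintro ⟨a, ha⟩
    exact ⟨star a, by rw [map_star, ha, star_star]⟩
  · rintro ⟨a, rfl⟩
    exact ⟨star a, map_star _ a⟩

/-- The von Neumann algebra `π_τ(A)''`, the double commutant of `π_τ(A)`. -/
def gnsVN {τ : StrongDual ℂ A} (hτ : τ ∈ tracialStates A) : VonNeumannAlgebra (GNSSpace hτ) where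
  toStarSubalgebra :=
    StarSubalgebra.centralizer ℂ
      (StarSubalgebra.centralizer ℂ (Set.range (gnsRep hτ)) : Set (GNSSpace hτ →L[ℂ] GNSSpace hτ))
  centralizer_centralizer' := by simp

theorem coe_gnsVN {τ : StrongDual ℂ A} (hτ : τ ∈ tracialStates A) :
    (gnsVN hτ : Set (GNSSpace hτ →L[ℂ] GNSSpace hτ)) =
      (Set.range (gnsRep hτ)).centralizer.centralizer := by
  change ((StarSubalgebra.centralizer ℂ (StarSubalgebra.centralizer ℂ (Set.range (gnsRep hτ)) :
    Set (GNSSpace hτ →L[ℂ] GNSSpace hτ)) : StarSubalgebra ℂ (GNSSpace hτ →L[ℂ] GNSSpace hτ)) :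
    Set (GNSSpace hτ →L[ℂ] GNSSpace hτ)) = _
  rw [StarSubalgebra.coe_centralizer_centralizer, star_range_gnsRep, Set.union_self]

theorem gnsRep_mem {τ : StrongDual ℂ A} (hτ : τ ∈ tracialStates A) (a : A) :
    gnsRep hτ a ∈ (gnsVN hτ).toStarSubalgebra := by
  rw [VonNeumannAlgebra.mem_carrier, coe_gnsVN]
  exact Set.subset_centralizer_centralizer (Set.mem_range_self a)

/-- `a ↦ β a` on the pre-Hilbert space underlying `H_τ`, for a `τ`-preserving automorphism `β`. -/
def preGNSMap {τ : StrongDual ℂ A} (hτ : τ ∈ tracialStates A) (β : A ≃⋆ₐ[ℂ] A)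
    (hβ : ∀ a, τ (β a) = τ a) : (toPositive hτ).PreGNS →L[ℂ] (toPositive hτ).PreGNS :=
  LinearMap.mkContinuous
    { toFun := fun x => (toPositive hτ).toPreGNS (β ((toPositive hτ).ofPreGNS x))
      map_add' := by simp
      map_smul' := by simp } 1 fun x => by
    simp [PositiveLinearMap.preGNS_norm_def, toPositive_apply, ← map_star, ← map_mul, hβ]

theorem preGNSMap_apply {τ : StrongDual ℂ A} (hτ : τ ∈ tracialStates A) (β : A ≃⋆ₐ[ℂ] A)
    (hβ : ∀ a, τ (β a) = τ a) (x : (toPositive hτ).PreGNS) :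
    preGNSMap hτ β hβ x = (toPositive hτ).toPreGNS (β ((toPositive hτ).ofPreGNS x)) := rfl

/-- The unitary on `H_τ` implementing a `τ`-preserving automorphism `β`: `[a] ↦ [β a]`. -/
def gnsUnitary {τ : StrongDual ℂ A} (hτ : τ ∈ tracialStates A) (β : A ≃⋆ₐ[ℂ] A)
    (hβ : ∀ a, τ (β a) = τ a) : unitary (GNSSpace hτ →L[ℂ] GNSSpace hτ) :=
  ⟨(preGNSMap hτ β hβ).completion, by
    have hs : star (preGNSMap hτ β hβ).completion =
        (preGNSMap hτ β.symm (symm_invariant hβ)).completion := by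
      refine ((ContinuousLinearMap.eq_adjoint_iff _ _).mpr fun x y => ?_).symm
      induction x, y using UniformSpace.Completion.induction_on₂ with
      | hp => apply isClosed_eq <;> fun_prop
      | ih x y =>
        simp only [ContinuousLinearMap.completion_apply_coe, UniformSpace.Completion.inner_coe,
          PositiveLinearMap.preGNS_inner_def, preGNSMap_apply, toPositive_apply,
          PositiveLinearMap.ofPreGNS_toPreGNS]
        rw [← hβ, map_mul, map_star, StarAlgEquiv.apply_symm_apply]
    rw [Unitary.mem_iff, hs]
    constructor <;>
    · ext x
      induction x using UniformSpace.Completion.induction_on with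
      | hp => apply isClosed_eq <;> fun_prop
      | ih x => simp [preGNSMap_apply]⟩

theorem gnsUnitary_conj {τ : StrongDual ℂ A} (hτ : τ ∈ tracialStates A) (β : A ≃⋆ₐ[ℂ] A)
    (hβ : ∀ a, τ (β a) = τ a) (a : A) :
    (gnsUnitary hτ β hβ : GNSSpace hτ →L[ℂ] GNSSpace hτ) * gnsRep hτ a *
      star (gnsUnitary hτ β hβ : GNSSpace hτ →L[ℂ] GNSSpace hτ) = gnsRep hτ (β a) := by
  have h : (gnsUnitary hτ β hβ : GNSSpace hτ →L[ℂ] GNSSpace hτ) * gnsRep hτ a =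
      gnsRep hτ (β a) * gnsUnitary hτ β hβ := by
    ext x
    induction x using UniformSpace.Completion.induction_on with
    | hp => apply isClosed_eq <;> fun_prop
    | ih x => simp [gnsUnitary, preGNSMap_apply]
  rw [h, mul_assoc, Unitary.mul_star_self_of_mem (gnsUnitary hτ β hβ).2, mul_one]

theorem map_mem_centralizer_centralizer {R : Type*} [Semiring R] [StarRing R] [Algebra ℂ R]
    (φ : R ≃⋆ₐ[ℂ] R) {S : Set R} (hS : ∀ s ∈ S, φ s ∈ S) {m : R}
    (hm : m ∈ S.centralizer.centralizer) : φ m ∈ S.centralizer.centralizer := by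
  intro z hz
  have hz' : φ.symm z ∈ S.centralizer := fun s hs => EquivLike.injective φ <| by
    rw [map_mul φ, map_mul φ, StarAlgEquiv.apply_symm_apply]
    exact hz (φ s) (hS s hs)
  have h := congrArg φ (hm _ hz')
  rwa [map_mul φ, map_mul φ, StarAlgEquiv.apply_symm_apply] at h

/-- Restriction of a `⋆`-automorphism to a `⋆`-subalgebra that it and its inverse preserve. -/
def restrictAut {R : Type*} [Semiring R] [StarRing R] [Algebra ℂ R] [StarModule ℂ R]
    (φ : R ≃⋆ₐ[ℂ] R) (M : StarSubalgebra ℂ R) (h₁ : ∀ m ∈ M, φ m ∈ M)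
    (h₂ : ∀ m ∈ M, φ.symm m ∈ M) : M ≃⋆ₐ[ℂ] M where
  toFun m := ⟨φ m, h₁ m m.2⟩
  invFun m := ⟨φ.symm m, h₂ m m.2⟩
  left_inv m := Subtype.ext (φ.symm_apply_apply _)
  right_inv m := Subtype.ext (φ.apply_symm_apply _)
  map_mul' x y := Subtype.ext (map_mul φ _ _)
  map_add' x y := Subtype.ext (map_add φ _ _)
  map_star' x := Subtype.ext (map_star φ _)
  map_smul' c x := Subtype.ext (map_smul φ c _)

/-- The extension `β̃` of a `τ`-preserving automorphism `β` of `A` to the von Neumann algebra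
`π_τ(A)''`: conjugation by the implementing unitary on `H_τ`. -/
def gnsAut {τ : StrongDual ℂ A} (hτ : τ ∈ tracialStates A) (β : A ≃⋆ₐ[ℂ] A)
    (hβ : ∀ a, τ (β a) = τ a) :
    (gnsVN hτ).toStarSubalgebra ≃⋆ₐ[ℂ] (gnsVN hτ).toStarSubalgebra :=
  let φ := Unitary.conjStarAlgAut ℂ (GNSSpace hτ →L[ℂ] GNSSpace hτ) (gnsUnitary hτ β hβ)
  have hφ (a : A) : φ (gnsRep hτ a) = gnsRep hτ (β a) := gnsUnitary_conj hτ β hβ a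
  have h₁ (m : GNSSpace hτ →L[ℂ] GNSSpace hτ) (hm : m ∈ (gnsVN hτ).toStarSubalgebra) :
      φ m ∈ (gnsVN hτ).toStarSubalgebra := by
    rw [VonNeumannAlgebra.mem_carrier, coe_gnsVN] at hm ⊢
    refine map_mem_centralizer_centralizer φ ?_ hm
    rintro _ ⟨a, rfl⟩
    exact ⟨β a, (hφ a).symm⟩
  have h₂ (m : GNSSpace hτ →L[ℂ] GNSSpace hτ) (hm : m ∈ (gnsVN hτ).toStarSubalgebra) :
      φ.symm m ∈ (gnsVN hτ).toStarSubalgebra := by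
    rw [VonNeumannAlgebra.mem_carrier, coe_gnsVN] at hm ⊢
    refine map_mem_centralizer_centralizer φ.symm ?_ hm
    rintro _ ⟨a, rfl⟩
    refine ⟨β.symm a, EquivLike.injective φ ?_⟩
    rw [StarAlgEquiv.apply_symm_apply, hφ, StarAlgEquiv.apply_symm_apply]
  restrictAut φ _ h₁ h₂

/-- `β̃` extends `β`: `β̃ (π_τ(a)) = π_τ(β a)`. -/
theorem gnsAut_gnsRep {τ : StrongDual ℂ A} (hτ : τ ∈ tracialStates A) (β : A ≃⋆ₐ[ℂ] A)
    (hβ : ∀ a, τ (β a) = τ a) (a : A) :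
    (gnsAut hτ β hβ ⟨gnsRep hτ a, gnsRep_mem hτ a⟩ : GNSSpace hτ →L[ℂ] GNSSpace hτ) = gnsRep hτ (β a) :=
  gnsUnitary_conj hτ β hβ a

end GNS

end CStarDyn

end

open scoped ComplexOrder

noncomputable section

namespace CStarDyn

open scoped InnerProductSpace
open Filter Topology

/-! Write ξ for the trace vector of H_τ, R_a for right multiplication [b] ↦ [ba], and λ for the
generator inside the crossed product. A trace φ on A ⋊ ℤ₂ restricts to τ on A, so it is known once b
↦ φ(bλ) is known. This twisted functional is encoded by one operator W on H_τ with ⟨[c], W[b]⟩ = φ(b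
c* λ) (`exists_implementer`). The trace identity for φ makes W a self-adjoint contraction that
commutes with every R_a and satisfies W π(a) = π(α(a)) W.

Two facts about H_τ do the rest. Commuting with all R_a is the same as lying in π_τ(A)''
(`mem_gnsVN_iff`, from the commutation theorem for the left and right representations). An operator
commuting with both representations is a scalar (`exists_eq_smul_one`), because a positive such
operator defines a positive tracial functional, hence a multiple of τ.

Two distinct traces cannot both have W = 0. For a nonzero W, the operator W*W = W² is a positive
scalar, and rescaling W gives a self-adjoint unitary implementing α
(`exists_symmetry_of_two_traces`). Conversely, given such a U, the covariant pairs (π, U) and (π,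
−U) give two distinct traces. For any other trace WU is a scalar, so W = tU with t real and |t| ≤ 1,
and the traces form a segment whose endpoints are these two (`encard_extremePoints_of_symmetry`). -/

theorem commute_apply {H : Type*} [NormedAddCommGroup H] [NormedSpace ℂ H] {S T : H →L[ℂ] H}
    (h : Commute S T) (x : H) : S (T x) = T (S x) :=
  DFunLike.congr_fun h.eq x

/-! ### Left and right multiplication on the GNS space of a trace; factoriality. -/

section GNSVectors

variable {A : Type*} [NonUnitalCStarAlgebra A] [PartialOrder A] [StarOrderedRing A]
  {τ : StrongDual ℂ A}

/-- The vector `[a]` of the GNS space. -/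
def gnsVec (hτ : τ ∈ tracialStates A) : A →ₗ[ℂ] GNSSpace hτ :=
  (UniformSpace.Completion.toComplL : (toPositive hτ).PreGNS →L[ℂ] GNSSpace hτ).toLinearMap ∘ₗ
    (toPositive hτ).toPreGNS.toLinearMap

theorem gnsVec_eq_coe (hτ : τ ∈ tracialStates A) (a : A) :
    gnsVec hτ a = ((toPositive hτ).toPreGNS a : GNSSpace hτ) := rfl

theorem inner_gnsVec (hτ : τ ∈ tracialStates A) (a b : A) :
    ⟪gnsVec hτ a, gnsVec hτ b⟫_ℂ = τ (star a * b) := by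
  rw [gnsVec_eq_coe, gnsVec_eq_coe, UniformSpace.Completion.inner_coe]
  rfl

theorem norm_gnsVec_sq (hτ : τ ∈ tracialStates A) (a : A) :
    ((‖gnsVec hτ a‖ ^ 2 : ℝ) : ℂ) = τ (star a * a) := by
  rw [← inner_gnsVec hτ, inner_self_eq_norm_sq_to_K]
  simp

theorem denseRange_gnsVec (hτ : τ ∈ tracialStates A) : DenseRange (gnsVec hτ) :=
  UniformSpace.Completion.denseRange_coe (α := (toPositive hτ).PreGNS)

theorem gnsRep_gnsVec (hτ : τ ∈ tracialStates A) (a b : A) :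
    gnsRep hτ a (gnsVec hτ b) = gnsVec hτ (a * b) := by
  rw [gnsVec_eq_coe, PositiveLinearMap.gnsNonUnitalStarAlgHom_apply_coe]
  rfl

theorem clm_ext_gnsVec (hτ : τ ∈ tracialStates A) {E : Type*} [NormedAddCommGroup E]
    [NormedSpace ℂ E] {S T : GNSSpace hτ →L[ℂ] E}
    (h : ∀ a, S (gnsVec hτ a) = T (gnsVec hτ a)) : S = T :=
  ContinuousLinearMap.coeFn_injective
    ((denseRange_gnsVec hτ).equalizer S.continuous T.continuous (funext h))

theorem eq_of_forall_inner_gnsVec (hτ : τ ∈ tracialStates A) {x y : GNSSpace hτ}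
    (h : ∀ c, ⟪gnsVec hτ c, x⟫_ℂ = ⟪gnsVec hτ c, y⟫_ℂ) : x = y := by
  have : innerSL ℂ x = innerSL ℂ y := clm_ext_gnsVec hτ fun c => by
    rw [innerSL_apply_apply, innerSL_apply_apply, ← inner_conj_symm, h c, inner_conj_symm]
  exact (innerSL_inj (𝕜 := ℂ)).mp this

theorem clm_ext_inner_gnsVec (hτ : τ ∈ tracialStates A) {S T : GNSSpace hτ →L[ℂ] GNSSpace hτ}
    (h : ∀ c b, ⟪gnsVec hτ c, S (gnsVec hτ b)⟫_ℂ = ⟪gnsVec hτ c, T (gnsVec hτ b)⟫_ℂ) : S = T :=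
  clm_ext_gnsVec hτ fun b => eq_of_forall_inner_gnsVec hτ fun c => h c b

/-- This is where traciality enters: the involution is isometric on H_τ, which makes right
multiplications bounded and lets limits pass through adjoints. -/
theorem norm_gnsVec_star (hτ : τ ∈ tracialStates A) (a : A) :
    ‖gnsVec hτ (star a)‖ = ‖gnsVec hτ a‖ := by
  have h : ((‖gnsVec hτ (star a)‖ ^ 2 : ℝ) : ℂ) = ((‖gnsVec hτ a‖ ^ 2 : ℝ) : ℂ) := by
    rw [norm_gnsVec_sq, norm_gnsVec_sq, star_star, hτ.2.2]
  exact (pow_left_inj₀ (norm_nonneg _) (norm_nonneg _) two_ne_zero).mp (Complex.ofReal_inj.mp h)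

theorem norm_gnsRep_le (hτ : τ ∈ tracialStates A) (a : A) : ‖gnsRep hτ a‖ ≤ ‖a‖ :=
  NonUnitalStarAlgHom.norm_apply_le _ a

theorem norm_gnsVec_mul_le (hτ : τ ∈ tracialStates A) (b a : A) :
    ‖gnsVec hτ (b * a)‖ ≤ ‖a‖ * ‖gnsVec hτ b‖ := by
  rw [← norm_gnsVec_star, star_mul, ← gnsRep_gnsVec, ← norm_gnsVec_star hτ b, ← norm_star a]
  exact (ContinuousLinearMap.le_opNorm _ _).trans
    (mul_le_mul_of_nonneg_right (norm_gnsRep_le hτ _) (norm_nonneg _))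

theorem norm_gnsVec_le (hτ : τ ∈ tracialStates A) (a : A) : ‖gnsVec hτ a‖ ≤ ‖a‖ := by
  have h := congrArg norm (norm_gnsVec_sq hτ a)
  rw [Complex.norm_real, Real.norm_of_nonneg (sq_nonneg _)] at h
  refine le_of_sq_le_sq ?_ (norm_nonneg a)
  rw [h]
  refine (τ.le_opNorm _).trans ?_
  rw [hτ.2.1, one_mul, CStarRing.norm_star_mul_self, sq]

/-- Right multiplication `[b] ↦ [b a]` on the GNS space of a trace. -/
def gnsRightMul (hτ : τ ∈ tracialStates A) (a : A) : GNSSpace hτ →L[ℂ] GNSSpace hτ :=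
  (LinearMap.mkContinuous ((toPositive hτ).toPreGNS.toLinearMap ∘ₗ
    (LinearMap.mulRight ℂ a) ∘ₗ (toPositive hτ).ofPreGNS.toLinearMap) ‖a‖ fun x => by
      have := norm_gnsVec_mul_le hτ ((toPositive hτ).ofPreGNS x) a
      rwa [gnsVec_eq_coe, gnsVec_eq_coe, UniformSpace.Completion.norm_coe,
        UniformSpace.Completion.norm_coe] at this).completion

theorem gnsRightMul_gnsVec (hτ : τ ∈ tracialStates A) (a b : A) :
    gnsRightMul hτ a (gnsVec hτ b) = gnsVec hτ (b * a) := by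
  rw [gnsVec_eq_coe, gnsRightMul, ContinuousLinearMap.completion_apply_coe]
  rfl

theorem star_gnsRightMul (hτ : τ ∈ tracialStates A) (a : A) :
    star (gnsRightMul hτ a) = gnsRightMul hτ (star a) := by
  refine clm_ext_inner_gnsVec hτ fun c b => ?_
  rw [ContinuousLinearMap.star_eq_adjoint, ContinuousLinearMap.adjoint_inner_right,
    gnsRightMul_gnsVec, gnsRightMul_gnsVec, inner_gnsVec, inner_gnsVec, star_mul, mul_assoc,
    hτ.2.2, mul_assoc]

theorem gnsRightMul_commute_gnsRep (hτ : τ ∈ tracialStates A) (a b : A) :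
    Commute (gnsRightMul hτ a) (gnsRep hτ b) :=
  clm_ext_gnsVec hτ fun c => by
    simp only [mul_apply_eq_comp, gnsRep_gnsVec, gnsRightMul_gnsVec, mul_assoc]

theorem exists_cyclic (hτ : τ ∈ tracialStates A) :
    ∃ ξ : GNSSpace hτ, ‖ξ‖ ≤ 1 ∧ (∀ a, ⟪ξ, gnsVec hτ a⟫_ℂ = τ a) := by
  -- With no unit to represent ξ, Cauchy–Schwarz against an approximate unit shows that τ is bounded
  -- for the GNS norm; Riesz representation then gives ξ.
  have hb (a : A) : ‖τ a‖ ≤ 1 * ‖gnsVec hτ a‖ := by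
    have hl := CStarAlgebra.increasingApproximateUnit A
    have ht : Tendsto (fun e : A => ‖τ (star e * a)‖) (CStarAlgebra.approximateUnit A)
        (𝓝 ‖τ a‖) := by
      refine ((τ.continuous.tendsto a).norm.comp (hl.tendsto_mul_right a)).congr' ?_
      filter_upwards [hl.eventually_star_eq] with e he
      simp [he]
    refine le_of_tendsto ht ?_
    filter_upwards [hl.eventually_norm] with e he
    rw [← inner_gnsVec hτ]
    refine (norm_inner_le_norm _ _).trans (mul_le_mul_of_nonneg_right ?_ (norm_nonneg _))
    exact (norm_gnsVec_le hτ e).trans he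
  let f₀ : (toPositive hτ).PreGNS →L[ℂ] ℂ :=
    LinearMap.mkContinuous ((τ : A →ₗ[ℂ] ℂ) ∘ₗ (toPositive hτ).ofPreGNS.toLinearMap) 1 fun x => by
      have := hb ((toPositive hτ).ofPreGNS x)
      rwa [gnsVec_eq_coe, UniformSpace.Completion.norm_coe] at this
  let f : GNSSpace hτ →L[ℂ] ℂ := f₀.fromCompletion
  have hf (a : A) : f (gnsVec hτ a) = τ a := by
    exact ContinuousLinearMap.fromCompletion_apply_coe f₀ _
  refine ⟨(InnerProductSpace.toDual ℂ _).symm f, ?_, fun a => ?_⟩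
  · rw [LinearIsometryEquiv.norm_map]
    refine ContinuousLinearMap.opNorm_le_bound _ zero_le_one fun x => ?_
    refine (denseRange_gnsVec hτ).induction_on x ?_ fun a => ?_
    · exact isClosed_le (by fun_prop) (by fun_prop)
    · rw [hf]; exact hb a
  · rw [InnerProductSpace.toDual_symm_apply, hf]

/-- The cyclic trace vector of the GNS space. -/
def gnsOne (hτ : τ ∈ tracialStates A) : GNSSpace hτ := (exists_cyclic hτ).choose

theorem norm_gnsOne_le (hτ : τ ∈ tracialStates A) : ‖gnsOne hτ‖ ≤ 1 :=
  (exists_cyclic hτ).choose_spec.1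

theorem inner_gnsOne_gnsVec (hτ : τ ∈ tracialStates A) (a : A) :
    ⟪gnsOne hτ, gnsVec hτ a⟫_ℂ = τ a :=
  (exists_cyclic hτ).choose_spec.2 a

theorem inner_star_apply {H : Type*} [NormedAddCommGroup H] [InnerProductSpace ℂ H]
    [CompleteSpace H] (S : H →L[ℂ] H) (x y : H) : ⟪star S x, y⟫_ℂ = ⟪x, S y⟫_ℂ := by
  rw [ContinuousLinearMap.star_eq_adjoint, ContinuousLinearMap.adjoint_inner_left]

theorem inner_gnsVec_gnsOne (hτ : τ ∈ tracialStates A) (a : A) :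
    ⟪gnsVec hτ a, gnsOne hτ⟫_ℂ = τ (star a) := by
  rw [← inner_conj_symm, inner_gnsOne_gnsVec]
  exact (map_star (toPositive hτ) a).symm

theorem gnsRep_gnsOne (hτ : τ ∈ tracialStates A) (a : A) :
    gnsRep hτ a (gnsOne hτ) = gnsVec hτ a := by
  refine eq_of_forall_inner_gnsVec hτ fun c => ?_
  rw [← inner_star_apply, ← map_star, gnsRep_gnsVec, inner_gnsVec_gnsOne, inner_gnsVec,
    star_mul, star_star]

theorem gnsRightMul_gnsOne (hτ : τ ∈ tracialStates A) (a : A) :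
    gnsRightMul hτ a (gnsOne hτ) = gnsVec hτ a := by
  refine eq_of_forall_inner_gnsVec hτ fun c => ?_
  rw [← inner_star_apply, star_gnsRightMul, gnsRightMul_gnsVec, inner_gnsVec_gnsOne, inner_gnsVec,
    star_mul, star_star, hτ.2.2]

/-- The commutation theorem: operators commuting with the left and with the right regular
representation commute with each other. -/
theorem commute_of_commute_gnsRep_of_commute_gnsRightMul (hτ : τ ∈ tracialStates A)
    {S W : GNSSpace hτ →L[ℂ] GNSSpace hτ} (hS : ∀ a, Commute S (gnsRep hτ a))
    (hW : ∀ a, Commute W (gnsRightMul hτ a)) : Commute W S := by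
  -- Approximating Sξ by vectors [aₙ] makes S a limit of the operators R_{aₙ}, in norm on each
  -- vector [b].
  obtain ⟨u, hu, hlim⟩ := mem_closure_iff_seq_limit.mp (denseRange_gnsVec hτ (S (gnsOne hτ)))
  choose a ha using hu
  have hSb (b : A) : Tendsto (fun n => gnsRightMul hτ (a n) (gnsVec hτ b)) atTop
      (𝓝 (S (gnsVec hτ b))) := by
    have h₁ : S (gnsVec hτ b) = gnsRep hτ b (S (gnsOne hτ)) := by
      rw [← gnsRep_gnsOne, commute_apply (hS b)]
    rw [h₁]
    refine (((gnsRep hτ b).continuous.tendsto _).comp hlim).congr fun n => ?_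
    rw [Function.comp_apply, ← ha, gnsRep_gnsVec, gnsRightMul_gnsVec]
  have hSx (c : A) (y : GNSSpace hτ) :
      Tendsto (fun n => ⟪gnsVec hτ c, gnsRightMul hτ (a n) y⟫_ℂ) atTop
        (𝓝 ⟪gnsVec hτ c, S y⟫_ℂ) := by
    -- The R_{aₙ} need not be uniformly bounded, so on a general vector y only weak convergence is
    -- proved: ⟨[c], R_{aₙ} y⟩ = ⟨π(c)[aₙ*], y⟩, and [aₙ*] converges because the involution is
    -- isometric.
    have hcau : CauchySeq fun n => gnsVec hτ (star (a n)) := by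
      refine Metric.cauchySeq_iff'.mpr fun ε hε => ?_
      obtain ⟨N, hN⟩ := Metric.cauchySeq_iff'.mp hlim.cauchySeq ε hε
      refine ⟨N, fun n hn => ?_⟩
      rw [dist_eq_norm, ← map_sub, ← star_sub, norm_gnsVec_star, map_sub, ha, ha, ← dist_eq_norm]
      exact hN n hn
    obtain ⟨η, hη⟩ := cauchySeq_tendsto_of_complete hcau
    have hstar (n : ℕ) (x : GNSSpace hτ) : ⟪gnsVec hτ c, gnsRightMul hτ (a n) x⟫_ℂ =
        ⟪gnsRep hτ c (gnsVec hτ (star (a n))), x⟫_ℂ := by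
      rw [← inner_star_apply, star_gnsRightMul, gnsRightMul_gnsVec, gnsRep_gnsVec]
    have hlim' (x : GNSSpace hτ) : Tendsto (fun n => ⟪gnsVec hτ c, gnsRightMul hτ (a n) x⟫_ℂ) atTop
        (𝓝 ⟪gnsRep hτ c η, x⟫_ℂ) :=
      ((((gnsRep hτ c).continuous.tendsto _).comp hη).inner tendsto_const_nhds).congr
        fun n => (hstar n x).symm
    have heq : gnsRep hτ c η = star S (gnsVec hτ c) := eq_of_forall_inner_gnsVec hτ fun b => by
      rw [← inner_conj_symm, ← inner_conj_symm _ (star S _), inner_star_apply]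
      exact congrArg _ (tendsto_nhds_unique (hlim' _) (tendsto_const_nhds.inner (hSb b)))
    rw [← inner_star_apply, ← heq]
    exact hlim' y
  refine clm_ext_inner_gnsVec hτ fun c b => ?_
  have h₁ : Tendsto (fun n => ⟪gnsVec hτ c, W (gnsRightMul hτ (a n) (gnsVec hτ b))⟫_ℂ) atTop
      (𝓝 ⟪gnsVec hτ c, W (S (gnsVec hτ b))⟫_ℂ) :=
    tendsto_const_nhds.inner ((W.continuous.tendsto _).comp (hSb b))
  refine tendsto_nhds_unique h₁ ((hSx c (W (gnsVec hτ b))).congr fun n => ?_)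
  rw [commute_apply (hW (a n))]

/-- Right multiplications lie in the commutant of π_τ(A), which gives one direction; the commutation
theorem gives the other. This replaces double-commutant membership by a condition that can be
checked on vectors [b]. -/
theorem mem_gnsVN_iff (hτ : τ ∈ tracialStates A) {W : GNSSpace hτ →L[ℂ] GNSSpace hτ} :
    W ∈ (gnsVN hτ).toStarSubalgebra ↔ ∀ a, Commute W (gnsRightMul hτ a) := by
  rw [VonNeumannAlgebra.mem_carrier, coe_gnsVN]
  refine ⟨fun h a => (h _ ?_).symm, fun h S hS => ?_⟩
  · rintro _ ⟨b, rfl⟩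
    exact (gnsRightMul_commute_gnsRep hτ a b).eq.symm
  · exact (commute_of_commute_gnsRep_of_commute_gnsRightMul hτ
      (fun a => (hS _ (Set.mem_range_self a)).symm) h).eq.symm

theorem inner_gnsOne_apply_gnsVec (hτ : τ ∈ tracialStates A)
    {W : GNSSpace hτ →L[ℂ] GNSSpace hτ} (hW : ∀ a, Commute W (gnsRightMul hτ a)) (a : A) :
    ⟪gnsOne hτ, W (gnsVec hτ a)⟫_ℂ = ⟪gnsOne hτ, gnsRep hτ a (W (gnsOne hτ))⟫_ℂ := by
  have h : W (gnsVec hτ a) = gnsRightMul hτ a (W (gnsOne hτ)) := by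
    rw [← gnsRightMul_gnsOne, commute_apply (hW a)]
  rw [h, ← inner_star_apply, star_gnsRightMul, gnsRightMul_gnsOne, ← gnsRep_gnsOne, map_star,
    inner_star_apply]

/-- A positive tracial functional is a multiple of the unique tracial state. -/
theorem eq_smul_of_unique {A : Type*} [NonUnitalCStarAlgebra A] {τ : StrongDual ℂ A}
    (hτ : tracialStates A = {τ}) {φ : StrongDual ℂ A} (hpos : ∀ a, 0 ≤ φ (star a * a))
    (htr : ∀ a b, φ (a * b) = φ (b * a)) : φ = (‖φ‖ : ℂ) • τ := by
  rcases eq_or_ne φ 0 with rfl | h0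
  · ext; simp
  have hn : (‖φ‖ : ℂ) ≠ 0 := by simpa using h0
  have hmem : (‖φ‖ : ℂ)⁻¹ • φ ∈ tracialStates A := by
    refine ⟨fun a => ?_, ?_, fun a b => ?_⟩
    · rw [smul_apply, smul_eq_mul, ← Complex.ofReal_inv]
      exact mul_nonneg (by simp) (hpos a)
    · rw [norm_smul, norm_inv, Complex.norm_real, norm_norm, inv_mul_cancel₀ (by simpa using h0)]
    · rw [smul_apply, smul_apply, htr]
  rw [hτ, Set.mem_singleton_iff] at hmem
  rw [← hmem, smul_inv_smul₀ hn]

theorem inner_gnsVec_apply (hτ : τ ∈ tracialStates A) {Z : GNSSpace hτ →L[ℂ] GNSSpace hτ}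
    (hL : ∀ a, Commute Z (gnsRep hτ a)) (a : A) (x : GNSSpace hτ) :
    ⟪gnsVec hτ a, Z x⟫_ℂ = ⟪gnsOne hτ, Z (gnsRep hτ (star a) x)⟫_ℂ := by
  rw [← gnsRep_gnsOne, ← star_star (gnsRep hτ a), inner_star_apply, ← map_star]
  rw [commute_apply (hL (star a))]

/-- For Z = Y*Y the functional a ↦ ⟨ξ, Z[a]⟩ is positive because φ(a*a) = ‖Y[a]‖², using commutation
with the left action. It is tracial because Z also commutes with the right action. Uniqueness makes
it a multiple of τ, and the matrix coefficients of Z then agree with those of a scalar. -/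
theorem star_mul_self_eq_smul_one (hm : τ ∈ tracialStates A) (hτ : tracialStates A = {τ})
    {Y : GNSSpace hm →L[ℂ] GNSSpace hm}
    (hL : ∀ a, Commute (star Y * Y) (gnsRep hm a))
    (hR : ∀ a, Commute (star Y * Y) (gnsRightMul hm a)) :
    ∃ r : ℝ, 0 ≤ r ∧ star Y * Y = (r : ℂ) • 1 := by
  have hZ (x y : GNSSpace hm) : ⟪x, (star Y * Y) y⟫_ℂ = ⟪Y x, Y y⟫_ℂ := by
    rw [mul_apply_eq_comp, ← inner_star_apply, star_star]
  set Z := star Y * Y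
  let φ : StrongDual ℂ A :=
    LinearMap.mkContinuous ((innerSL ℂ (gnsOne hm) ∘L Z).toLinearMap ∘ₗ gnsVec hm)
      ‖innerSL ℂ (gnsOne hm) ∘L Z‖ fun a =>
        ((innerSL ℂ (gnsOne hm) ∘L Z).le_opNorm (gnsVec hm a)).trans
          (mul_le_mul_of_nonneg_left (norm_gnsVec_le hm a) (norm_nonneg _))
  have hφ (a : A) : φ a = ⟪gnsOne hm, Z (gnsVec hm a)⟫_ℂ := rfl
  have hφ' (a b : A) : φ (star a * b) = ⟪gnsVec hm a, Z (gnsVec hm b)⟫_ℂ := by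
    rw [inner_gnsVec_apply hm hL, gnsRep_gnsVec, hφ]
  have h := eq_smul_of_unique hτ (φ := φ) (fun a => ?_) fun a b => ?_
  · refine ⟨‖φ‖, norm_nonneg _, clm_ext_inner_gnsVec hm fun c b => ?_⟩
    have hcb : φ (star c * b) = (‖φ‖ : ℂ) * τ (star c * b) := DFunLike.congr_fun h (star c * b)
    rw [← hφ', hcb, smul_apply, inner_smul_right, one_apply_eq_self, inner_gnsVec]
  · rw [hφ', hZ, inner_self_eq_norm_sq_to_K]
    exact (Complex.zero_le_real.mpr (sq_nonneg ‖Y (gnsVec hm a)‖)).trans_eq (Complex.ofReal_pow _ _)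
  · rw [← star_star a, hφ', star_star, hφ, ← gnsRep_gnsOne hm (b * a), ← star_star (b * a),
      ← inner_gnsVec_apply hm hL, ← gnsRightMul_gnsOne hm b, star_mul, ← gnsRightMul_gnsVec,
      ← star_gnsRightMul, inner_star_apply, commute_apply (hR b)]

theorem commute_star_of_forall {R ι : Type*} [Mul R] [StarMul R] [InvolutiveStar ι] {f : ι → R}
    (hf : ∀ i, star (f i) = f (star i)) {z : R} (hz : ∀ i, Commute z (f i)) (i : ι) :
    Commute (star z) (f i) := by
  have := (hz (star i)).star_star
  rwa [hf, star_star] at this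

/-- Polarization reduces a general operator to operators of the form Y*Y with Y = 1 + cz, to which
the positive case applies. -/
theorem polarization_one {R : Type*} [Ring R] [StarRing R] [Algebra ℂ R] [StarModule ℂ R]
    (z : R) : z = (1 / 4 : ℂ) •
      ((star (1 + (1 : ℂ) • z) * (1 + (1 : ℂ) • z) - star (1 + (-1 : ℂ) • z) * (1 + (-1 : ℂ) • z)) -
      Complex.I • (star (1 + Complex.I • z) * (1 + Complex.I • z) -
        star (1 + (-Complex.I) • z) * (1 + (-Complex.I) • z))) := by
  simp only [star_add, star_smul, star_one, mul_add, add_mul, mul_one, one_mul, smul_mul_smul_comm]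
  simp only [star_neg, star_one, Complex.star_def, Complex.conj_I]
  match_scalars
  · linear_combination (1 / 2) * Complex.I_sq
  · ring
  · linear_combination (-1 / 2) * Complex.I_sq
  · ring

/-- Operators commuting with both regular representations are scalars: `π_τ(A)''` is a factor. -/
theorem exists_eq_smul_one (hm : τ ∈ tracialStates A) (hτ : tracialStates A = {τ})
    {z : GNSSpace hm →L[ℂ] GNSSpace hm} (hL : ∀ a, Commute z (gnsRep hm a))
    (hR : ∀ a, Commute z (gnsRightMul hm a)) : ∃ c : ℂ, z = c • 1 := by
  have hL' := commute_star_of_forall (fun a => (map_star (gnsRep hm) a).symm) hL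
  have hR' := commute_star_of_forall (star_gnsRightMul hm) hR
  have key (c : ℂ) : ∃ r : ℝ, 0 ≤ r ∧ star (1 + c • z) * (1 + c • z) = (r : ℂ) • 1 := by
    refine star_mul_self_eq_smul_one hm hτ (fun a => ?_) fun a => ?_
    · rw [star_add, star_one, star_smul]
      exact ((Commute.one_left _).add_left ((hL' a).smul_left _)).mul_left
        ((Commute.one_left _).add_left ((hL a).smul_left _))
    · rw [star_add, star_one, star_smul]
      exact ((Commute.one_left _).add_left ((hR' a).smul_left _)).mul_left
        ((Commute.one_left _).add_left ((hR a).smul_left _))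
  obtain ⟨r, -, hr⟩ := key 1
  obtain ⟨s, -, hs⟩ := key (-1)
  obtain ⟨t, -, ht⟩ := key Complex.I
  obtain ⟨v, -, hv⟩ := key (-Complex.I)
  refine ⟨(1 / 4 : ℂ) * ((r - s) - Complex.I * (t - v)), ?_⟩
  rw [polarization_one z, hr, hs, ht, hv, ← sub_smul, ← sub_smul, smul_smul, ← sub_smul, smul_smul]

end GNSVectors

/-! ### Coordinates a + bλ on the crossed product by ℤ₂. -/

section CrossedProductTwo

variable {A : Type*} [NonUnitalCStarAlgebra A]
  (α : Multiplicative (ZMod 2) →* (A ≃⋆ₐ[ℂ] A))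

/-- The automorphism given by the generator of `ℤ₂`. -/
abbrev genAut : A ≃⋆ₐ[ℂ] A := α (Multiplicative.ofAdd 1)

theorem genAut_genAut (a : A) : genAut α (genAut α a) = a := by
  rw [← StarAlgEquiv.mul_apply, ← map_mul]
  have : (Multiplicative.ofAdd 1 * Multiplicative.ofAdd 1 : Multiplicative (ZMod 2)) = 1 := by decide
  rw [this, map_one, StarAlgEquiv.one_apply]

/-- The element `a + b λ` of `A ⋊_α ℤ₂`. -/
def crossedPair (a b : A) : crossedProduct α :=
  ⟨regularRep α fun s => if s = 1 then a else b, _, rfl⟩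

theorem forall_zmodTwo {P : Multiplicative (ZMod 2) → Prop} (h₁ : P 1)
    (h₂ : P (Multiplicative.ofAdd 1)) (s : Multiplicative (ZMod 2)) : P s := by
  revert s
  change ∀ s : Fin 2, _
  exact Fin.forall_fin_two.mpr ⟨h₁, h₂⟩

theorem coe_crossedPair (a b : A) : (crossedPair α a b : CStarMatrix _ _ A) =
    regularRep α fun s => if s = 1 then a else b := rfl

theorem exists_crossedPair (x : crossedProduct α) : ∃ a b, crossedPair α a b = x := by
  obtain ⟨_, f, rfl⟩ := x
  have h : (fun s => if s = 1 then f 1 else f (Multiplicative.ofAdd 1)) = f :=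
    funext (forall_zmodTwo (if_pos rfl) (if_neg (by decide)))
  exact ⟨f 1, f (Multiplicative.ofAdd 1), Subtype.ext (congrArg (regularRep α) h)⟩

theorem crossedPair_add (a b c d : A) :
    crossedPair α a b + crossedPair α c d = crossedPair α (a + c) (b + d) := by
  refine Subtype.ext (CStarMatrix.ext fun g h => ?_)
  simp only [NonUnitalStarSubalgebra.coe_add, coe_crossedPair, CStarMatrix.add_apply,
    regularRep_apply, ← map_add]
  split_ifs <;> rfl

theorem crossedPair_smul (c : ℂ) (a b : A) :
    c • crossedPair α a b = crossedPair α (c • a) (c • b) := by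
  refine Subtype.ext (CStarMatrix.ext fun g h => ?_)
  simp only [NonUnitalStarSubalgebra.coe_smul, coe_crossedPair, CStarMatrix.smul_apply,
    regularRep_apply, ← map_smul]
  split_ifs <;> rfl

theorem crossedPair_mul (a b c d : A) : crossedPair α a b * crossedPair α c d =
    crossedPair α (a * c + b * genAut α d) (a * d + b * genAut α c) := by
  refine Subtype.ext (CStarMatrix.ext fun g h => ?_)
  have hne : Multiplicative.ofAdd (1 : ZMod 2) ≠ 1 := by decide
  have hsq : Multiplicative.ofAdd (1 : ZMod 2) * Multiplicative.ofAdd 1 = 1 := by decide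
  have hinv : (Multiplicative.ofAdd (1 : ZMod 2))⁻¹ = Multiplicative.ofAdd 1 := by decide
  have huniv : (Finset.univ : Finset (Multiplicative (ZMod 2))) = {1, Multiplicative.ofAdd 1} := by
    decide
  simp only [NonUnitalStarSubalgebra.coe_mul, coe_crossedPair, CStarMatrix.mul_apply,
    regularRep_apply, huniv]
  rw [Finset.sum_pair hne.symm]
  revert g h
  refine forall_zmodTwo (forall_zmodTwo ?_ ?_) (forall_zmodTwo ?_ ?_) <;>
    simp [hne, hsq, hinv, genAut_genAut, add_comm]

theorem star_crossedPair (a b : A) :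
    star (crossedPair α a b) = crossedPair α (star a) (genAut α (star b)) := by
  refine Subtype.ext (CStarMatrix.ext fun g h => ?_)
  have hne : Multiplicative.ofAdd (1 : ZMod 2) ≠ 1 := by decide
  have hsq : Multiplicative.ofAdd (1 : ZMod 2) * Multiplicative.ofAdd 1 = 1 := by decide
  have hinv : (Multiplicative.ofAdd (1 : ZMod 2))⁻¹ = Multiplicative.ofAdd 1 := by decide
  change star (crossedPair α a b : CStarMatrix _ _ A) g h = _
  simp only [coe_crossedPair, CStarMatrix.star_apply, regularRep_apply]
  revert g h
  refine forall_zmodTwo (forall_zmodTwo ?_ ?_) (forall_zmodTwo ?_ ?_) <;>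
    simp [hne, hsq, hinv, genAut_genAut, ← map_star]

/-- The projections of `A ⋊_α ℤ₂` onto the coefficients. -/
def crossedCoeff (s : Multiplicative (ZMod 2)) : crossedProduct α →ₗ[ℂ] A where
  toFun x := (x : CStarMatrix (Multiplicative (ZMod 2)) (Multiplicative (ZMod 2)) A) 1 s⁻¹
  map_add' _ _ := rfl
  map_smul' _ _ := rfl

theorem crossedCoeff_one_crossedPair (a b : A) : crossedCoeff α 1 (crossedPair α a b) = a := by
  simp [crossedCoeff, coe_crossedPair, regularRep_apply]

theorem crossedCoeff_gen_crossedPair (a b : A) :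
    crossedCoeff α (Multiplicative.ofAdd 1) (crossedPair α a b) = b := by
  have hne : Multiplicative.ofAdd (1 : ZMod 2) ≠ 1 := by decide
  change (crossedPair α a b : CStarMatrix (Multiplicative (ZMod 2)) _ A) 1
    (Multiplicative.ofAdd (1 : ZMod 2))⁻¹ = b
  rw [coe_crossedPair, regularRep_apply, inv_inv, one_mul, if_neg hne, inv_one, map_one,
    StarAlgEquiv.one_apply]

/-- The inclusion of `A` in the crossed product. -/
def crossedIncl : A →⋆ₙₐ[ℂ] crossedProduct α where
  toFun a := crossedPair α a 0
  map_smul' c a := by simp [crossedPair_smul]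
  map_zero' := by
    have := crossedPair_smul α 0 0 0
    rwa [zero_smul, zero_smul, eq_comm] at this
  map_add' a b := by simp [crossedPair_add]
  map_mul' a b := by simp [crossedPair_mul]
  map_star' a := by simp [star_crossedPair]

theorem continuous_crossedPair : Continuous fun p : A × A => crossedPair α p.1 p.2 := by
  refine continuous_induced_rng.mpr (continuous_pi fun g => continuous_pi fun h => ?_)
  change Continuous fun p : A × A => α g⁻¹ (if g * h⁻¹ = 1 then p.1 else p.2)
  refine (isometry_aut _).continuous.comp ?_
  split_ifs <;> fun_prop

variable [PartialOrder A] [StarOrderedRing A]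

theorem norm_crossedPair_left_le (a : A) : ‖crossedPair α a 0‖ ≤ ‖a‖ :=
  NonUnitalStarAlgHom.norm_apply_le (crossedIncl α) a

/-- An approximate unit of A is a left approximate unit for the crossed product, so the norm of a
trace on the crossed product can be controlled by its restriction to A. -/
theorem tendsto_crossedPair_mul (x : crossedProduct α) :
    Tendsto (fun e => crossedPair α e 0 * x) (CStarAlgebra.approximateUnit A) (𝓝 x) := by
  obtain ⟨a, b, rfl⟩ := exists_crossedPair α x
  have hl := CStarAlgebra.increasingApproximateUnit A
  refine (((continuous_crossedPair α).tendsto (a, b)).comp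
    ((hl.tendsto_mul_right a).prodMk_nhds (hl.tendsto_mul_right b))).congr fun e => ?_
  simp [crossedPair_mul]

end CrossedProductTwo

/-! ### Traces built from a self-adjoint unitary implementing the action. -/

section DualTraces

variable {A : Type*} [NonUnitalCStarAlgebra A]

/-- The representation of `A ⋊_α ℤ₂` given by a covariant pair. -/
def covariantRep (α : Multiplicative (ZMod 2) →* (A ≃⋆ₐ[ℂ] A)) {R : Type*} [Ring R] [StarRing R]
    [Algebra ℂ R] [StarModule ℂ R] (π : A →⋆ₙₐ[ℂ] R) (U : R) (hstar : star U = U) (hsq : U * U = 1)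
    (hcov : ∀ a, U * π a = π (genAut α a) * U) : crossedProduct α →⋆ₙₐ[ℂ] R where
  toFun x := π (crossedCoeff α 1 x) + π (crossedCoeff α (Multiplicative.ofAdd 1) x) * U
  map_smul' c x := by simp
  map_zero' := by simp
  map_add' x y := by simp only [map_add, add_mul]; abel
  map_mul' x y := by
    obtain ⟨a, b, rfl⟩ := exists_crossedPair α x
    obtain ⟨c, d, rfl⟩ := exists_crossedPair α y
    simp only [crossedPair_mul, crossedCoeff_one_crossedPair, crossedCoeff_gen_crossedPair,
      map_add, map_mul]
    have h (c : A) : π b * U * π c = π b * π (genAut α c) * U := by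
      rw [mul_assoc, hcov, mul_assoc]
    have h' : π b * U * (π d * U) = π b * π (genAut α d) := by
      rw [← mul_assoc, h, mul_assoc, hsq, mul_one]
    rw [add_mul (π a), mul_add (π a), mul_add (π b * U), h, h', add_mul, mul_assoc (π a)]
    abel
  map_star' x := by
    obtain ⟨a, b, rfl⟩ := exists_crossedPair α x
    simp only [star_crossedPair, crossedCoeff_one_crossedPair, crossedCoeff_gen_crossedPair,
      star_add, star_mul, hstar, ← map_star, hcov]

theorem covariantRep_crossedPair (α : Multiplicative (ZMod 2) →* (A ≃⋆ₐ[ℂ] A)) {R : Type*} [Ring R]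
    [StarRing R] [Algebra ℂ R] [StarModule ℂ R] (π : A →⋆ₙₐ[ℂ] R) (U : R) (hstar : star U = U)
    (hsq : U * U = 1) (hcov : ∀ a, U * π a = π (genAut α a) * U) (a b : A) :
    covariantRep α π U hstar hsq hcov (crossedPair α a b) = π a + π b * U := by
  change π _ + π _ * U = _
  rw [crossedCoeff_one_crossedPair, crossedCoeff_gen_crossedPair]

variable [PartialOrder A] [StarOrderedRing A] {τ : StrongDual ℂ A}

theorem inner_gnsOne_gnsRep_gnsOne (hτ : τ ∈ tracialStates A) (a : A) :
    ⟪gnsOne hτ, gnsRep hτ a (gnsOne hτ)⟫_ℂ = τ a := by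
  rw [gnsRep_gnsOne, inner_gnsOne_gnsVec]

/-- Evaluate U[ab] = U R_b π(a)ξ by moving U past R_b and then past π(a), which becomes π(α(a));
finally R_b*ξ = [b*] = π(b)*ξ. This twisted trace identity handles the λ-coefficients in
`dualTrace_mem`. -/
theorem inner_gnsOne_mul_of_covariant (α : Multiplicative (ZMod 2) →* (A ≃⋆ₐ[ℂ] A))
    (hτ : τ ∈ tracialStates A) {U : GNSSpace hτ →L[ℂ] GNSSpace hτ}
    (hcov : ∀ a, U * gnsRep hτ a = gnsRep hτ (genAut α a) * U)
    (hR : ∀ a, Commute U (gnsRightMul hτ a)) (a b : A) :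
    ⟪gnsOne hτ, gnsRep hτ (a * b) (U (gnsOne hτ))⟫_ℂ =
      ⟪gnsOne hτ, gnsRep hτ (b * genAut α a) (U (gnsOne hτ))⟫_ℂ := by
  have h : U (gnsVec hτ (a * b)) = gnsRightMul hτ b (gnsRep hτ (genAut α a) (U (gnsOne hτ))) := by
    rw [← gnsRightMul_gnsVec, commute_apply (hR b), ← gnsRep_gnsOne]
    exact congrArg _ (DFunLike.congr_fun (hcov a) (gnsOne hτ))
  rw [← inner_gnsOne_apply_gnsVec hτ hR, h, ← inner_star_apply, star_gnsRightMul,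
    gnsRightMul_gnsOne, ← gnsRep_gnsOne, map_star, inner_star_apply, map_mul, mul_apply_eq_comp]

/-- The tracial functional `a + b λ ↦ ⟪ξ, (π(a) + π(b) U) ξ⟫`. -/
def dualTrace (α : Multiplicative (ZMod 2) →* (A ≃⋆ₐ[ℂ] A)) (hτ : τ ∈ tracialStates A)
    (U : GNSSpace hτ →L[ℂ] GNSSpace hτ) (hstar : star U = U) (hsq : U * U = 1)
    (hcov : ∀ a, U * gnsRep hτ a = gnsRep hτ (genAut α a) * U) :
    StrongDual ℂ (crossedProduct α) :=
  LinearMap.mkContinuous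
    { toFun := fun x => ⟪gnsOne hτ, covariantRep α (gnsRep hτ) U hstar hsq hcov x (gnsOne hτ)⟫_ℂ
      map_add' := fun x y => by rw [map_add, add_apply, inner_add_right]
      map_smul' := fun c x => by
        rw [map_smul, smul_apply, inner_smul_right, RingHom.id_apply, smul_eq_mul] } 1 fun x => by
    refine (norm_inner_le_norm _ _).trans (mul_le_mul (norm_gnsOne_le hτ) ?_ (norm_nonneg _)
      zero_le_one)
    refine ((covariantRep α (gnsRep hτ) U hstar hsq hcov x).le_of_opNorm_le_of_le
      (NonUnitalStarAlgHom.norm_apply_le _ x) (norm_gnsOne_le hτ)).trans_eq (mul_one _)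

theorem dualTrace_crossedPair (α : Multiplicative (ZMod 2) →* (A ≃⋆ₐ[ℂ] A))
    (hτ : τ ∈ tracialStates A) (U : GNSSpace hτ →L[ℂ] GNSSpace hτ) (hstar : star U = U)
    (hsq : U * U = 1) (hcov : ∀ a, U * gnsRep hτ a = gnsRep hτ (genAut α a) * U) (a b : A) :
    dualTrace α hτ U hstar hsq hcov (crossedPair α a b) =
      τ a + ⟪gnsOne hτ, gnsRep hτ b (U (gnsOne hτ))⟫_ℂ := by
  change ⟪gnsOne hτ, covariantRep α (gnsRep hτ) U hstar hsq hcov (crossedPair α a b)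
    (gnsOne hτ)⟫_ℂ = _
  rw [covariantRep_crossedPair, add_apply, inner_add_right, inner_gnsOne_gnsRep_gnsOne,
    mul_apply_eq_comp]

theorem dualTrace_mem (α : Multiplicative (ZMod 2) →* (A ≃⋆ₐ[ℂ] A))
    (hτ : τ ∈ tracialStates A) (hinv : ∀ a, τ (genAut α a) = τ a)
    (U : GNSSpace hτ →L[ℂ] GNSSpace hτ) (hstar : star U = U)
    (hsq : U * U = 1) (hcov : ∀ a, U * gnsRep hτ a = gnsRep hτ (genAut α a) * U)
    (hR : ∀ a, Commute U (gnsRightMul hτ a)) :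
    dualTrace α hτ U hstar hsq hcov ∈ tracialStates (crossedProduct α) := by
  refine ⟨fun x => ?_, le_antisymm ?_ ?_, fun x y => ?_⟩
  · change 0 ≤ ⟪gnsOne hτ, covariantRep α (gnsRep hτ) U hstar hsq hcov (star x * x) (gnsOne hτ)⟫_ℂ
    rw [map_mul, map_star, mul_apply_eq_comp, ← inner_star_apply, star_star,
      inner_self_eq_norm_sq_to_K]
    exact (Complex.zero_le_real.mpr (sq_nonneg _)).trans_eq (Complex.ofReal_pow _ _)
  · exact LinearMap.mkContinuous_norm_le _ zero_le_one _
  -- The functional restricts to τ on A, and the inclusion of A is contractive, so its norm is at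
  -- least ‖τ‖ = 1.
  · rw [← hτ.2.1]
    refine τ.opNorm_le_bound (norm_nonneg _) fun a => ?_
    have h := (dualTrace α hτ U hstar hsq hcov).le_of_opNorm_le_of_le le_rfl
      (norm_crossedPair_left_le α a)
    rwa [dualTrace_crossedPair, map_zero, zero_apply, inner_zero_right, add_zero] at h
  · obtain ⟨a, b, rfl⟩ := exists_crossedPair α x
    obtain ⟨c, d, rfl⟩ := exists_crossedPair α y
    have h₁ : τ (b * genAut α d) = τ (d * genAut α b) := by
      rw [← hinv, map_mul, genAut_genAut, hτ.2.2]
    simp only [crossedPair_mul, dualTrace_crossedPair, map_add, add_apply, inner_add_right, h₁,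
      hτ.2.2 a c, inner_gnsOne_mul_of_covariant α hτ hcov hR a d,
      inner_gnsOne_mul_of_covariant α hτ hcov hR c b]
    ring

end DualTraces

/-! ### From a trace on the crossed product to an implementing operator. -/

section Restriction

variable {A : Type*} [NonUnitalCStarAlgebra A] [PartialOrder A] [StarOrderedRing A]
  {τ : StrongDual ℂ A}

/-- A linear map which is isometric for the trace seminorms extends to the GNS spaces. -/
theorem exists_gnsMap {B : Type*} [NonUnitalCStarAlgebra B] [PartialOrder B] [StarOrderedRing B]
    {φ : StrongDual ℂ B} (hτ : τ ∈ tracialStates A) (hφ : φ ∈ tracialStates B) (f : A →ₗ[ℂ] B)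
    (hf : ∀ a, φ (star (f a) * f a) = τ (star a * a)) :
    ∃ F : GNSSpace hτ →L[ℂ] GNSSpace hφ, ‖F‖ ≤ 1 ∧ ∀ a, F (gnsVec hτ a) = gnsVec hφ (f a) := by
  let F₀ : (toPositive hτ).PreGNS →L[ℂ] (toPositive hφ).PreGNS :=
    LinearMap.mkContinuous ((toPositive hφ).toPreGNS.toLinearMap ∘ₗ f ∘ₗ
      (toPositive hτ).ofPreGNS.toLinearMap) 1 fun x => by
      simp [PositiveLinearMap.preGNS_norm_def, toPositive_apply, hf]
  have hF (a : A) : F₀.completion (gnsVec hτ a) = gnsVec hφ (f a) := by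
    rw [gnsVec_eq_coe, ContinuousLinearMap.completion_apply_coe]
    rfl
  refine ⟨F₀.completion, ContinuousLinearMap.opNorm_le_bound _ zero_le_one fun x => ?_, hF⟩
  refine (denseRange_gnsVec hτ).induction_on x (isClosed_le (by fun_prop) (by fun_prop))
    fun a => ?_
  refine le_of_sq_le_sq ?_ (by positivity)
  rw [hF, one_mul, ← Complex.real_le_real, norm_gnsVec_sq, norm_gnsVec_sq, hf]

theorem norm_apply_star_mul_le {B : Type*} [NonUnitalCStarAlgebra B] {φ : StrongDual ℂ B}
    (hφ : φ ∈ tracialStates B) (x y : B) :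
    ‖φ (star x * y)‖ ≤ √‖φ (star x * x)‖ * ‖y‖ := by
  -- The GNS construction needs an order on the algebra; the spectral order supplies one.
  let _ := CStarAlgebra.spectralOrder B
  let _ := CStarAlgebra.spectralOrderedRing B
  rw [← inner_gnsVec hφ, ← norm_gnsVec_sq hφ, Complex.norm_real, Real.norm_of_nonneg (sq_nonneg _),
    Real.sqrt_sq (norm_nonneg _)]
  exact (norm_inner_le_norm _ _).trans
    (mul_le_mul_of_nonneg_left (norm_gnsVec_le hφ y) (norm_nonneg _))

theorem apply_star_of_mem_tracialStates {B : Type*} [NonUnitalCStarAlgebra B]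
    {φ : StrongDual ℂ B} (hφ : φ ∈ tracialStates B) (x : B) : φ (star x) = star (φ x) := by
  let _ := CStarAlgebra.spectralOrder B
  let _ := CStarAlgebra.spectralOrderedRing B
  exact map_star (toPositive hφ) x

theorem apply_crossedPair_left (α : Multiplicative (ZMod 2) →* (A ≃⋆ₐ[ℂ] A))
    (hτ : tracialStates A = {τ}) {φ : StrongDual ℂ (crossedProduct α)}
    (hφ : φ ∈ tracialStates (crossedProduct α)) (a : A) : φ (crossedPair α a 0) = τ a := by
  let f : StrongDual ℂ A := LinearMap.mkContinuous
    ((φ : crossedProduct α →ₗ[ℂ] ℂ) ∘ₗ (crossedIncl α : A →ₗ[ℂ] crossedProduct α)) 1 fun a => by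
      rw [← hφ.2.1]
      exact φ.le_of_opNorm_le_of_le le_rfl (norm_crossedPair_left_le α a)
  have hf (a : A) : f a = φ (crossedIncl α a) := rfl
  have h := eq_smul_of_unique hτ (φ := f)
    (fun a => by rw [hf, map_mul (crossedIncl α), map_star]; exact hφ.1 _)
    (fun a b => by rw [hf, hf, map_mul (crossedIncl α), map_mul (crossedIncl α)]; exact hφ.2.2 _ _)
  have h₁ : ‖f‖ ≤ 1 := LinearMap.mkContinuous_norm_le _ zero_le_one _
  -- The restriction f is ‖f‖·τ, and ‖f‖ must be shown not to drop below 1. Cauchy–Schwarz gives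
  -- |φ(ex)| ≤ √|f(e²)| ‖x‖ along the approximate unit, hence 1 = ‖φ‖ ≤ √‖f‖.
  have h₂ : ‖φ‖ ≤ √‖f‖ := by
    refine φ.opNorm_le_bound (Real.sqrt_nonneg _) fun x => ?_
    refine le_of_tendsto ((φ.continuous.tendsto x).norm.comp (tendsto_crossedPair_mul α x)) ?_
    have hl := CStarAlgebra.increasingApproximateUnit A
    filter_upwards [hl.eventually_norm, hl.eventually_star_eq] with e he hs
    have hc := norm_apply_star_mul_le hφ (crossedIncl α e) x
    rw [← map_star, hs, ← map_mul, ← hf] at hc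
    refine hc.trans (mul_le_mul_of_nonneg_right (Real.sqrt_le_sqrt ?_) (norm_nonneg _))
    refine (f.le_opNorm _).trans (mul_le_of_le_one_right (norm_nonneg _) ?_)
    exact (norm_mul_le _ _).trans (mul_le_one₀ he (norm_nonneg _) he)
  rw [hφ.2.1, Real.one_le_sqrt] at h₂
  rw [le_antisymm h₁ h₂, Complex.ofReal_one, one_smul] at h
  rw [← h]
  rfl

theorem apply_crossedPair_right_mul (α : Multiplicative (ZMod 2) →* (A ≃⋆ₐ[ℂ] A))
    {φ : StrongDual ℂ (crossedProduct α)} (hφ : φ ∈ tracialStates (crossedProduct α)) (a b : A) :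
    φ (crossedPair α 0 (a * b)) = φ (crossedPair α 0 (b * genAut α a)) := by
  have h := hφ.2.2 (crossedPair α a 0) (crossedPair α 0 b)
  simpa [crossedPair_mul] using h

theorem apply_crossedPair (α : Multiplicative (ZMod 2) →* (A ≃⋆ₐ[ℂ] A))
    (hτ : tracialStates A = {τ}) {φ : StrongDual ℂ (crossedProduct α)}
    (hφ : φ ∈ tracialStates (crossedProduct α)) (a b : A) :
    φ (crossedPair α a b) = τ a + φ (crossedPair α 0 b) := by
  rw [← apply_crossedPair_left α hτ hφ, ← map_add, crossedPair_add, add_zero, zero_add]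

/-- A trace on the crossed product comes from a contraction `W` implementing the automorphism:
`φ (b λ) = ⟪ξ, π(b) W ξ⟫`. -/
theorem exists_implementer (α : Multiplicative (ZMod 2) →* (A ≃⋆ₐ[ℂ] A))
    (hm : τ ∈ tracialStates A) (hτ : tracialStates A = {τ}) {φ : StrongDual ℂ (crossedProduct α)}
    (hφ : φ ∈ tracialStates (crossedProduct α)) :
    ∃ W : GNSSpace hm →L[ℂ] GNSSpace hm, ‖W‖ ≤ 1 ∧
      ∀ c b, ⟪gnsVec hm c, W (gnsVec hm b)⟫_ℂ = φ (crossedPair α 0 (b * star c)) := by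
  let _ := CStarAlgebra.spectralOrder (crossedProduct α)
  let _ := CStarAlgebra.spectralOrderedRing (crossedProduct α)
  -- W is F*F' for the isometric maps F : [c] ↦ [α(c)] and F' : [b] ↦ [bλ] into the GNS space of φ.
  -- The twist in F is chosen so that moving α(c*) to the right of b applies α a second time and
  -- leaves c*.
  obtain ⟨F, hF₁, hF⟩ := exists_gnsMap hm hφ
    { toFun := fun c => crossedPair α (genAut α c) 0
      map_add' := by simp [crossedPair_add]
      map_smul' := by simp [crossedPair_smul] } fun a => by
      simp [star_crossedPair, crossedPair_mul, ← map_star, ← map_mul, apply_crossedPair_left α hτ hφ,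
        invariant_of_unique hτ]
  obtain ⟨F', hF'₁, hF'⟩ := exists_gnsMap hm hφ
    { toFun := fun b => crossedPair α 0 b
      map_add' := by simp [crossedPair_add]
      map_smul' := by simp [crossedPair_smul] } fun a => by
      simp [star_crossedPair, crossedPair_mul, ← map_mul, apply_crossedPair_left α hτ hφ,
        invariant_of_unique hτ]
  refine ⟨ContinuousLinearMap.adjoint F ∘L F', ?_, fun c b => ?_⟩
  · refine (ContinuousLinearMap.opNorm_comp_le _ _).trans (mul_le_one₀ ?_ (norm_nonneg _) hF'₁)
    rwa [LinearIsometryEquiv.norm_map]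
  · rw [ContinuousLinearMap.comp_apply, ContinuousLinearMap.adjoint_inner_right, hF, hF',
      inner_gnsVec]
    have := apply_crossedPair_right_mul α hφ (genAut α (star c)) b
    rw [genAut_genAut] at this
    simpa [star_crossedPair, crossedPair_mul, ← map_star] using this

variable {α : Multiplicative (ZMod 2) →* (A ≃⋆ₐ[ℂ] A)} {hm : τ ∈ tracialStates A}
  {φ : StrongDual ℂ (crossedProduct α)} {W : GNSSpace hm →L[ℂ] GNSSpace hm}

/-- The coefficients depend only on the product b c*, so a right factor can be moved from b to c. -/
theorem implementer_commute
    (hW : ∀ c b, ⟪gnsVec hm c, W (gnsVec hm b)⟫_ℂ = φ (crossedPair α 0 (b * star c))) (a : A) :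
    Commute W (gnsRightMul hm a) := by
  refine clm_ext_inner_gnsVec hm fun c b => ?_
  rw [mul_apply_eq_comp, mul_apply_eq_comp, gnsRightMul_gnsVec, hW, ← inner_star_apply,
    star_gnsRightMul, gnsRightMul_gnsVec, hW, star_mul, star_star, mul_assoc]

theorem implementer_covariant (hφ : φ ∈ tracialStates (crossedProduct α))
    (hW : ∀ c b, ⟪gnsVec hm c, W (gnsVec hm b)⟫_ℂ = φ (crossedPair α 0 (b * star c))) (a : A) :
    W * gnsRep hm a = gnsRep hm (genAut α a) * W := by
  refine clm_ext_inner_gnsVec hm fun c b => ?_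
  rw [mul_apply_eq_comp, mul_apply_eq_comp, gnsRep_gnsVec, hW, ← inner_star_apply, ← map_star,
    gnsRep_gnsVec, hW, star_mul, star_star, ← mul_assoc, ← apply_crossedPair_right_mul α hφ,
    mul_assoc]

theorem star_implementer (hφ : φ ∈ tracialStates (crossedProduct α))
    (hW : ∀ c b, ⟪gnsVec hm c, W (gnsVec hm b)⟫_ℂ = φ (crossedPair α 0 (b * star c))) :
    star W = W := by
  refine clm_ext_inner_gnsVec hm fun c b => ?_
  rw [← inner_star_apply, star_star, ← inner_conj_symm, hW, hW]
  -- Since (c b* λ)* = α(b c*) λ, two uses of the twisted trace identity remove α from the factors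
  -- one at a time.
  have h := apply_star_of_mem_tracialStates hφ (crossedPair α 0 (c * star b))
  rw [star_crossedPair, star_zero, star_mul, star_star,
    map_mul, ← apply_crossedPair_right_mul α hφ, ← apply_crossedPair_right_mul α hφ] at h
  exact h.symm

/-- The value of a trace on the crossed product is determined by its values on products. -/
theorem eq_of_forall_mul_star (f g : StrongDual ℂ (crossedProduct α))
    (h : ∀ b c, f (crossedPair α 0 (b * star c)) = g (crossedPair α 0 (b * star c))) (b : A) :
    f (crossedPair α 0 b) = g (crossedPair α 0 b) := by
  have hl := CStarAlgebra.increasingApproximateUnit A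
  have hc : Tendsto (fun e => crossedPair α 0 (b * e)) (CStarAlgebra.approximateUnit A)
      (𝓝 (crossedPair α 0 b)) := by
    have h₀ : Tendsto (fun e => ((0 : A), b * e)) (CStarAlgebra.approximateUnit A) (𝓝 (0, b)) :=
      tendsto_const_nhds.prodMk_nhds (hl.tendsto_mul_left b)
    exact (((continuous_crossedPair α).tendsto (0, b)).comp h₀).congr fun _ => rfl
  refine tendsto_nhds_unique ((f.continuous.tendsto _).comp hc)
    (((g.continuous.tendsto _).comp hc).congr fun e => ?_)
  have he := h b (star e)
  rw [star_star] at he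
  exact he.symm

end Restriction

/-! ### Extreme points of a set contained in a segment. -/

section Extreme

theorem left_mem_extremePoints_of_subset_segment {E : Type*} [AddCommGroup E] [Module ℝ E]
    {S : Set E} {p q : E} (hp : p ∈ S) (hS : S ⊆ segment ℝ p q) : p ∈ S.extremePoints ℝ := by
  refine ⟨hp, fun x hx y hy hxy => ?_⟩
  rcases eq_or_ne p q with rfl | hpq
  · simpa using hS hx
  have hx' := hS hx
  have hy' := hS hy
  rw [segment_eq_image'] at hx' hy'
  obtain ⟨s, hs, rfl⟩ := hx'
  obtain ⟨t, ht, rfl⟩ := hy'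
  obtain ⟨a, b, ha, hb, hab, h⟩ := hxy
  -- Measured from p, the parameters s and t are nonnegative, so a convex combination equal to p
  -- with positive weights forces both to vanish.
  have h₁ : (a * s + b * t) • (q - p) = 0 := by
    have h₂ : a • (p + s • (q - p)) + b • (p + t • (q - p)) =
        (a + b) • p + (a * s + b * t) • (q - p) := by module
    rw [h₂, hab, one_smul] at h
    exact left_eq_add.mp h.symm
  have h₂ : a * s + b * t = 0 := (smul_eq_zero.mp h₁).resolve_right (sub_ne_zero.mpr hpq.symm)
  have h₃ : a * s = 0 := by nlinarith [mul_nonneg ha.le hs.1, mul_nonneg hb.le ht.1]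
  have h₄ : s = 0 := (mul_eq_zero.mp h₃).resolve_left ha.ne'
  change p + s • (q - p) = p
  rw [h₄, zero_smul, add_zero]

theorem extremePoints_eq_pair {E : Type*} [AddCommGroup E] [Module ℝ E]
    {S : Set E} {p q : E} (hp : p ∈ S) (hq : q ∈ S) (hS : S ⊆ segment ℝ p q) :
    S.extremePoints ℝ = {p, q} := by
  refine Set.Subset.antisymm (fun x hx => ?_) (Set.insert_subset_iff.mpr
    ⟨left_mem_extremePoints_of_subset_segment hp hS, Set.singleton_subset_iff.mpr
      (left_mem_extremePoints_of_subset_segment hq (segment_symm ℝ p q ▸ hS))⟩)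
  have h := hS hx.1
  rw [← insert_endpoints_openSegment] at h
  rcases h with rfl | rfl | h
  · exact Set.mem_insert _ _
  · exact Set.mem_insert_of_mem _ rfl
  · exact Or.inl (hx.2 hp hq h).symm

end Extreme

/-! ### Symmetries in the von Neumann algebra and the segment of traces. -/

section Main

variable {A : Type*} [NonUnitalCStarAlgebra A] [PartialOrder A] [StarOrderedRing A]
  {τ : StrongDual ℂ A}

theorem gnsAut_eq_conj_iff (hτ : τ ∈ tracialStates A) (β : A ≃⋆ₐ[ℂ] A) (hβ : ∀ a, τ (β a) = τ a)
    (U : unitary (gnsVN hτ).toStarSubalgebra) :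
    gnsAut hτ β hβ = Unitary.conjStarAlgAut ℂ (gnsVN hτ).toStarSubalgebra U ↔
      ∀ a, (U : (gnsVN hτ).toStarSubalgebra) * gnsRep hτ a =
        gnsRep hτ (β a) * ((U : (gnsVN hτ).toStarSubalgebra) : GNSSpace hτ →L[ℂ] GNSSpace hτ) := by
  have hU : star ((U : (gnsVN hτ).toStarSubalgebra) : GNSSpace hτ →L[ℂ] GNSSpace hτ) *
      (U : (gnsVN hτ).toStarSubalgebra) = 1 := congrArg Subtype.val (Unitary.coe_star_mul_self U)
  have hU' : ((U : (gnsVN hτ).toStarSubalgebra) : GNSSpace hτ →L[ℂ] GNSSpace hτ) *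
      star ((U : (gnsVN hτ).toStarSubalgebra) : GNSSpace hτ →L[ℂ] GNSSpace hτ) = 1 :=
    congrArg Subtype.val (Unitary.coe_mul_star_self U)
  constructor
  · intro h a
    have h₁ := gnsAut_gnsRep hτ β hβ a
    rw [h, Unitary.conjStarAlgAut_apply] at h₁
    change ((U : (gnsVN hτ).toStarSubalgebra) : GNSSpace hτ →L[ℂ] GNSSpace hτ) * gnsRep hτ a *
      star ((U : (gnsVN hτ).toStarSubalgebra) : GNSSpace hτ →L[ℂ] GNSSpace hτ) = _ at h₁
    rw [← h₁, mul_assoc _ (star _), hU, mul_one]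
  · intro h
    refine StarAlgEquiv.ext fun m => Subtype.ext ?_
    rw [Unitary.conjStarAlgAut_apply]
    change (gnsUnitary hτ β hβ : GNSSpace hτ →L[ℂ] GNSSpace hτ) *
      (m : GNSSpace hτ →L[ℂ] GNSSpace hτ) *
      star (gnsUnitary hτ β hβ : GNSSpace hτ →L[ℂ] GNSSpace hτ) =
      ((U : (gnsVN hτ).toStarSubalgebra) : GNSSpace hτ →L[ℂ] GNSSpace hτ) * m *
      star ((U : (gnsVN hτ).toStarSubalgebra) : GNSSpace hτ →L[ℂ] GNSSpace hτ)
    set V := (gnsUnitary hτ β hβ : GNSSpace hτ →L[ℂ] GNSSpace hτ)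
    set u := ((U : (gnsVN hτ).toStarSubalgebra) : GNSSpace hτ →L[ℂ] GNSSpace hτ)
    have hV : star V * V = 1 := Unitary.star_mul_self_of_mem (gnsUnitary hτ β hβ).2
    have hV' : V * star V = 1 := Unitary.mul_star_self_of_mem (gnsUnitary hτ β hβ).2
    have hcov (a : A) : V * gnsRep hτ a = gnsRep hτ (β a) * V := by
      rw [← gnsUnitary_conj hτ β hβ a, mul_assoc _ (star _), hV, mul_one]
    have hm : (m : GNSSpace hτ →L[ℂ] GNSSpace hτ) ∈
        (Set.range (gnsRep hτ)).centralizer.centralizer := by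
      rw [← coe_gnsVN]
      exact m.2
    -- Both u and V implement β on π(A), so u*V lies in the commutant of π(A) and hence commutes
    -- with m.
    have hc : star u * V ∈ (Set.range (gnsRep hτ)).centralizer := by
      rintro _ ⟨a, rfl⟩
      have h₁ : star u * gnsRep hτ (β a) = gnsRep hτ a * star u := by
        calc _ = star u * (gnsRep hτ (β a) * u) * star u := by
              rw [mul_assoc, mul_assoc, hU', mul_one]
          _ = _ := by rw [← h a, ← mul_assoc, hU, one_mul]
      rw [mul_assoc, hcov, ← mul_assoc, ← mul_assoc, h₁]
    calc V * (m : GNSSpace hτ →L[ℂ] GNSSpace hτ) * star V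
        = u * ((star u * V) * m) * star V := by
          rw [← mul_assoc, ← mul_assoc, hU', one_mul]
      _ = u * m * star u := by
          rw [hm _ hc]
          simp only [mul_assoc]
          rw [hV', mul_one]

theorem star_eq_self_and_mul_self_eq_one (hτ : τ ∈ tracialStates A)
    {U : unitary (gnsVN hτ).toStarSubalgebra} (h : U ^ 2 = 1) :
    star (U.1.1 : GNSSpace hτ →L[ℂ] GNSSpace hτ) = U.1.1 ∧ U.1.1 * U.1.1 = 1 := by
  have h₁ : U.1.1 * U.1.1 = 1 := by
    rw [← sq]
    exact congrArg (fun u : unitary (gnsVN hτ).toStarSubalgebra => u.1.1) h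
  have h₂ : star (U.1.1 : GNSSpace hτ →L[ℂ] GNSSpace hτ) * U.1.1 = 1 :=
    congrArg Subtype.val (Unitary.coe_star_mul_self U)
  exact ⟨by rw [← mul_one (star _), ← h₁, ← mul_assoc, h₂, one_mul], h₁⟩

theorem gnsOne_ne_zero (hτ : τ ∈ tracialStates A) : gnsOne hτ ≠ 0 := by
  intro h
  have h₀ : τ = 0 := by
    ext a
    rw [← inner_gnsOne_gnsVec hτ, h, inner_zero_left, zero_apply]
  simpa [h₀] using hτ.2.1

theorem inner_gnsVec_eq_inner_gnsOne (hτ : τ ∈ tracialStates A)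
    {U : GNSSpace hτ →L[ℂ] GNSSpace hτ} (hR : ∀ a, Commute U (gnsRightMul hτ a)) (c b : A) :
    ⟪gnsVec hτ c, U (gnsVec hτ b)⟫_ℂ = ⟪gnsOne hτ, gnsRep hτ (b * star c) (U (gnsOne hτ))⟫_ℂ := by
  rw [← gnsRightMul_gnsOne hτ b, commute_apply (hR b), ← inner_star_apply, star_gnsRightMul,
    gnsRightMul_gnsVec, ← gnsRep_gnsOne, ← star_star (gnsRep hτ (c * star b)), inner_star_apply,
    ← map_star, star_mul, star_star]

variable {α : Multiplicative (ZMod 2) →* (A ≃⋆ₐ[ℂ] A)}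

theorem mul_mul_gnsRep_of_covariant {hm : τ ∈ tracialStates A}
    {W U : GNSSpace hm →L[ℂ] GNSSpace hm}
    (hW : ∀ a, W * gnsRep hm a = gnsRep hm (genAut α a) * W)
    (hU : ∀ a, U * gnsRep hm a = gnsRep hm (genAut α a) * U) (a : A) :
    Commute (W * U) (gnsRep hm a) := by
  change W * U * _ = _
  rw [mul_assoc, hU, ← mul_assoc, hW, genAut_genAut, mul_assoc]

/-- Only the value formula is asked of ψ, so it may be a combination of traces not yet known to be a
trace. -/
theorem ext_of_implementer_eq_smul (hm : τ ∈ tracialStates A) (hτ : tracialStates A = {τ})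
    {φ ψ : StrongDual ℂ (crossedProduct α)} (hφ : φ ∈ tracialStates (crossedProduct α))
    (hψ : ∀ a b, ψ (crossedPair α a b) = τ a + ψ (crossedPair α 0 b))
    {W : GNSSpace hm →L[ℂ] GNSSpace hm}
    (hW : ∀ c b, ⟪gnsVec hm c, W (gnsVec hm b)⟫_ℂ = φ (crossedPair α 0 (b * star c)))
    (hW' : ∀ c b, ⟪gnsVec hm c, W (gnsVec hm b)⟫_ℂ = ψ (crossedPair α 0 (b * star c))) :
    φ = ψ := by
  ext x
  obtain ⟨a, b, rfl⟩ := exists_crossedPair α x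
  rw [apply_crossedPair α hτ hφ, hψ, eq_of_forall_mul_star φ ψ fun b c => by rw [← hW, hW']]

theorem exists_symmetry_of_two_traces (hm : τ ∈ tracialStates A) (hτ : tracialStates A = {τ})
    {φ ψ : StrongDual ℂ (crossedProduct α)} (hφ : φ ∈ tracialStates (crossedProduct α))
    (hψ : ψ ∈ tracialStates (crossedProduct α)) (hne : φ ≠ ψ) :
    ∃ U : GNSSpace hm →L[ℂ] GNSSpace hm, star U = U ∧ U * U = 1 ∧
      (∀ a, U * gnsRep hm a = gnsRep hm (genAut α a) * U) ∧
      ∀ a, Commute U (gnsRightMul hm a) := by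
  obtain ⟨W, -, hW⟩ := exists_implementer α hm hτ hφ
  obtain ⟨W', -, hW'⟩ := exists_implementer α hm hτ hψ
  -- If both operators vanished, both traces would be a + bλ ↦ τ(a), contradicting that they differ.
  wlog h0 : W ≠ 0 generalizing φ ψ W W'
  · refine this hψ hφ hne.symm W' hW' W hW fun h0' => hne ?_
    refine ext_of_implementer_eq_smul hm hτ hφ (apply_crossedPair α hτ hψ) hW fun c b => ?_
    rw [← hW', not_not.mp h0, h0']
  have hs := star_implementer hφ hW
  have hcov := implementer_covariant hφ hW
  have hR := implementer_commute hW
  obtain ⟨r, hr, h⟩ := star_mul_self_eq_smul_one hm hτ (Y := W)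
    (fun a => by rw [hs]; exact mul_mul_gnsRep_of_covariant hcov hcov a)
    (fun a => by rw [hs]; exact (hR a).mul_left (hR a))
  have hr0 : r ≠ 0 := by
    rintro rfl
    rw [Complex.ofReal_zero, zero_smul] at h
    have h₁ : ‖W‖ * ‖W‖ = 0 := by rw [← CStarRing.norm_star_mul_self, h, norm_zero]
    exact h0 (norm_eq_zero.mp (mul_self_eq_zero.mp h₁))
  have hsq : (((√r)⁻¹ : ℝ) : ℂ) * (((√r)⁻¹ : ℝ) : ℂ) * r = 1 := by
    rw [← Complex.ofReal_mul, ← Complex.ofReal_mul, ← mul_inv, Real.mul_self_sqrt hr,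
      inv_mul_cancel₀ hr0, Complex.ofReal_one]
  refine ⟨(((√r)⁻¹ : ℝ) : ℂ) • W, ?_, ?_, fun a => ?_, fun a => (hR a).smul_left _⟩
  · rw [star_smul, hs, Complex.star_def, Complex.conj_ofReal]
  · rw [hs] at h
    rw [smul_mul_smul_comm, h, smul_smul, hsq, one_smul]
  · rw [smul_mul_assoc, hcov, mul_smul_comm]

theorem encard_extremePoints_of_symmetry (hm : τ ∈ tracialStates A) (hτ : tracialStates A = {τ})
    {U : GNSSpace hm →L[ℂ] GNSSpace hm} (hstar : star U = U) (hsq : U * U = 1)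
    (hcov : ∀ a, U * gnsRep hm a = gnsRep hm (genAut α a) * U)
    (hR : ∀ a, Commute U (gnsRightMul hm a)) :
    (Set.extremePoints ℝ (tracialStates (crossedProduct α))).encard = 2 := by
  have hinv := invariant_of_unique hτ (genAut α)
  have hstar' : star (-U) = -U := by rw [star_neg, hstar]
  have hsq' : -U * -U = 1 := by rw [neg_mul_neg, hsq]
  have hcov' (a : A) : -U * gnsRep hm a = gnsRep hm (genAut α a) * -U := by
    rw [neg_mul, hcov, mul_neg]
  have hR' (a : A) : Commute (-U) (gnsRightMul hm a) := (hR a).neg_left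
  set p := dualTrace α hm U hstar hsq hcov with hp
  set q := dualTrace α hm (-U) hstar' hsq' hcov' with hq
  have hpa (a b : A) : p (crossedPair α a b) =
      τ a + ⟪gnsOne hm, gnsRep hm b (U (gnsOne hm))⟫_ℂ := dualTrace_crossedPair ..
  have hqa (a b : A) : q (crossedPair α a b) =
      τ a - ⟪gnsOne hm, gnsRep hm b (U (gnsOne hm))⟫_ℂ := by
    rw [hq, dualTrace_crossedPair, neg_apply, map_neg, inner_neg_right, sub_eq_add_neg]
  have hp_mem : p ∈ tracialStates (crossedProduct α) := dualTrace_mem α hm hinv U hstar hsq hcov hR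
  have hq_mem : q ∈ tracialStates (crossedProduct α) :=
    dualTrace_mem α hm hinv (-U) hstar' hsq' hcov' hR'
  have hUone : U (gnsOne hm) ≠ 0 := by
    intro h
    refine gnsOne_ne_zero hm ?_
    have h₁ : (U * U) (gnsOne hm) = 0 := by rw [mul_apply_eq_comp, h, map_zero]
    rwa [hsq, one_apply_eq_self] at h₁
  have hpq : p ≠ q := by
    intro h
    refine hUone (eq_of_forall_inner_gnsVec hm fun c => ?_)
    have h₁ := DFunLike.congr_fun h (crossedPair α 0 (star c))
    rw [hpa, hqa, map_zero, zero_add, zero_sub, self_eq_neg, map_star, ← inner_star_apply,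
      star_star, gnsRep_gnsOne] at h₁
    rw [h₁, inner_zero_right]
  rw [extremePoints_eq_pair hp_mem hq_mem ?_, Set.encard_pair hpq]
  intro φ hφ
  obtain ⟨W, hW1, hW⟩ := exists_implementer α hm hτ hφ
  obtain ⟨c, hc⟩ := exists_eq_smul_one hm hτ (z := W * U)
    (mul_mul_gnsRep_of_covariant (implementer_covariant hφ hW) hcov)
    fun a => (implementer_commute hW a).mul_left (hR a)
  -- Since U² = 1, the scalar WU = c gives W = cU; self-adjointness of W then makes c real, and
  -- contractivity gives |c| ≤ 1.
  have hWc : W = c • U := by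
    rw [← mul_one W, ← hsq, ← mul_assoc, hc, smul_mul_assoc, one_mul]
  have hreal : star c = c := by
    have h₁ := star_implementer hφ hW
    rw [hWc, star_smul, hstar] at h₁
    exact smul_left_injective ℂ hUone (DFunLike.congr_fun h₁ (gnsOne hm))
  obtain ⟨t, rfl⟩ : ∃ t : ℝ, (t : ℂ) = c :=
    Complex.conj_eq_iff_real.mp hreal |>.imp fun _ h => h.symm
  have hU1 : ‖U‖ ≤ 1 := by
    have h₁ : ‖U‖ * ‖U‖ ≤ 1 := by
      rw [← CStarRing.norm_star_mul_self, hstar, hsq]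
      exact ContinuousLinearMap.norm_id_le
    nlinarith [norm_nonneg U]
  have ht : |t| ≤ 1 := by
    have h₁ : ‖(W * U) (gnsOne hm)‖ ≤ 1 * ‖gnsOne hm‖ :=
      (W * U).le_of_opNorm_le ((norm_mul_le _ _).trans (mul_le_one₀ hW1 (norm_nonneg _) hU1)) _
    rw [hc, smul_apply, one_apply_eq_self, norm_smul, Complex.norm_real] at h₁
    exact le_of_mul_le_mul_right h₁ (norm_pos_iff.mpr (gnsOne_ne_zero hm))
  obtain ⟨ht₁, ht₂⟩ := abs_le.mp ht
  -- The endpoints p and q correspond to t = 1 and t = −1, which fixes the weights.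
  refine ⟨(1 + t) / 2, (1 - t) / 2, by linarith, by linarith, by ring, ?_⟩
  have hval (a b : A) : (((1 + t) / 2) • p + ((1 - t) / 2) • q) (crossedPair α a b) =
      τ a + t * ⟪gnsOne hm, gnsRep hm b (U (gnsOne hm))⟫_ℂ := by
    rw [add_apply, smul_apply, smul_apply, hpa, hqa, Complex.real_smul, Complex.real_smul]
    push_cast
    ring
  refine (ext_of_implementer_eq_smul hm hτ hφ (fun a b => ?_) hW fun c b => ?_).symm
  · rw [hval, hval, map_zero, zero_add]
  · rw [hval, map_zero, zero_add, hWc, smul_apply, inner_smul_right,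
      inner_gnsVec_eq_inner_gnsOne hm hR]

end Main

end CStarDyn

end

theorem proposition2p5 {A : Type*} [NonUnitalCStarAlgebra A] [PartialOrder A] [StarOrderedRing A]
    [TopologicalSpace.SeparableSpace A] (hA : CStarDyn.IsSimple A)
    (τ : StrongDual ℂ A) (hτ : CStarDyn.tracialStates A = {τ})
    (α : Multiplicative (ZMod 2) →* (A ≃⋆ₐ[ℂ] A)) :
    (Set.extremePoints ℝ (CStarDyn.tracialStates (CStarDyn.crossedProduct α))).encard = 2 ↔
      ∃ U : unitary (CStarDyn.gnsVN (CStarDyn.mem_of_unique hτ)).toStarSubalgebra,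
        CStarDyn.gnsAut (CStarDyn.mem_of_unique hτ) (α (Multiplicative.ofAdd 1))
            (CStarDyn.invariant_of_unique hτ (α (Multiplicative.ofAdd 1))) =
          Unitary.conjStarAlgAut ℂ
            (CStarDyn.gnsVN (CStarDyn.mem_of_unique hτ)).toStarSubalgebra U ∧
        U ^ 2 = 1 := by
  constructor
  · intro h
    obtain ⟨φ, ψ, hne, hφψ⟩ := Set.encard_eq_two.mp h
    have hφ : φ ∈ Set.extremePoints ℝ (CStarDyn.tracialStates (CStarDyn.crossedProduct α)) :=
      hφψ ▸ Set.mem_insert φ {ψ}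
    have hψ : ψ ∈ Set.extremePoints ℝ (CStarDyn.tracialStates (CStarDyn.crossedProduct α)) :=
      hφψ ▸ Set.mem_insert_of_mem φ rfl
    obtain ⟨U, hstar, hsq, hcov, hR⟩ := CStarDyn.exists_symmetry_of_two_traces
      (CStarDyn.mem_of_unique hτ) hτ hφ.1 hψ.1 hne
    refine ⟨⟨⟨U, (CStarDyn.mem_gnsVN_iff _).mpr hR⟩, Unitary.mem_iff.mpr
      ⟨Subtype.ext ?_, Subtype.ext ?_⟩⟩, (CStarDyn.gnsAut_eq_conj_iff _ _ _ _).mpr hcov,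
      Subtype.ext (Subtype.ext ?_)⟩
    · exact (congrArg (· * U) hstar).trans hsq
    · exact (congrArg (U * ·) hstar).trans hsq
    · exact (sq U).trans hsq
  · rintro ⟨U, hU, hsq⟩
    have hmem := (U : (CStarDyn.gnsVN (CStarDyn.mem_of_unique hτ)).toStarSubalgebra).2
    obtain ⟨hstar, hone⟩ := CStarDyn.star_eq_self_and_mul_self_eq_one _ hsq
    have hcov := (CStarDyn.gnsAut_eq_conj_iff _ _ _ U).mp hU
    have hR := (CStarDyn.mem_gnsVN_iff _).mp hmem
    exact CStarDyn.encard_extremePoints_of_symmetry (CStarDyn.mem_of_unique hτ) hτ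
      hstar hone hcov hR
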